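/- Let $g\ge 0$ be an integer and let $\mathbb{R}\langle x\rangle$ be the free associative real algebra in the noncommuting variables $x=(x_1,\dots,x_g)$, with the linear involution ${}^{\intercal}$ that reverses words and fixes each $x_j$. Call $p\in\mathbb{R}\langle x\rangle$ symmetric if $p^{\intercal}=p$, and let its degree be the length of the longest word that appears in $p$ with nonzero coefficient (with $\deg 0=-\infty$). For $n\ge 1$ let $(\mathbb{S}^{n\times n})^g$ be the set of $g$-tuples $X=(X_1,\dots,X_g)$ of real symmetric $n\times n$ matrices; $p(X)$ is the matrix obtained by replacing each $x_j$ by $X_j$. An nc basic open semialgebraic set is a sequence $\mathcal{O}=(\mathcal{O}(n))_{n\ge1}$ of the form $$\mathcal{O}(n)=\{X\in(\mathbb{S}^{n\times n})^g : q_1(X)\succ0,\dots,q_k(X)\succ0\}$$ for a finite list of symmetric polynomials $q_1,\dots,q_k\in\mathbb{R}\langle x\rangle$; it is nonempty if $\mathcal{O}(n)\neq\emptyset$ for some $n\ge1$. A symmetric $p$ is (matrix) convex on $\mathcal{O}$ if for every $n\ge1$, all $X,Y$ such that the line segment from $X$ to $Y$ lies in $\mathcal{O}(n)$, and all $0\le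 t\le1$, $$t\,p(X)+(1-t)\,p(Y)-p\big(tX+(1-t)Y\big)\succeq0 .$$ **Theorem.** If $p\in\mathbb{R}\langle x\rangle$ is a symmetric polynomial that is convex on some nonempty nc basic open semialgebraic set $\mathcal{O}$, then $p$ has degree at most two. -/

import Mathlib

/-- `NCPoly g` is the algebra `ℝ⟨x₁, …, x_g⟩` of nc polynomials. Its `star` is the involution that
reverses words and fixes the real scalars and the variables (the variables are symmetric). -/
abbrev NCPoly (g : ℕ) : Type := FreeAlgebra ℝ (Fin g)

namespace NCPoly

/-- The set of `g`-tuples of real symmetric `n × n` matrices. -/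
def SymTuples (g n : ℕ) : Set (Fin g → Matrix (Fin n) (Fin n) ℝ) :=
  {X | ∀ i, (X i).IsSymm}

/-- The evaluation `p(X)`, obtained by replacing each variable `x i` by the matrix `X i`. -/
noncomputable def eval {g n : ℕ} (X : Fin g → Matrix (Fin n) (Fin n) ℝ) (p : NCPoly g) :
    Matrix (Fin n) (Fin n) ℝ :=
  FreeAlgebra.lift ℝ X p

/-- `p` is symmetric: it equals its image under the word-reversing involution. -/
def IsSymmetric {g : ℕ} (p : NCPoly g) : Prop := star p = p

/-- The degree of `p`: the length of the longest word appearing in `p` (and `⊥` for `p = 0`). -/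
noncomputable def degree {g : ℕ} (p : NCPoly g) : WithBot ℕ :=
  (FreeAlgebra.equivMonoidAlgebraFreeMonoid p).coeff.support.sup
    fun w : FreeMonoid (Fin g) => ((w.length : ℕ) : WithBot ℕ)

/-- `O = (O(n))ₙ` is a nc basic open semialgebraic set: for some finite list `q₁, …, q_k` of
symmetric nc polynomials, `O(n)` consists, for each positive integer `n`, of the `g`-tuples `X` of
symmetric `n × n` matrices for which all `q_j(X)` are positive definite. The (meaningless) level
`n = 0` is ignored here and in the notions below. -/
def IsBasicOpenSemialgebraic {g : ℕ} (O : ∀ n : ℕ, Set (Fin g → Matrix (Fin n) (Fin n) ℝ)) :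
    Prop :=
  ∃ (k : ℕ) (q : Fin k → NCPoly g), (∀ j, (q j).IsSymmetric) ∧
    ∀ n : ℕ, 0 < n → O n = {X | X ∈ SymTuples g n ∧ ∀ j, (eval X (q j)).PosDef}

/-- `p` is (matrix) convex on `O`: for each positive integer `n`, the convexity inequality holds
along every line segment that lies in `O(n)`. The set `O(n)` need not be convex; if it
is, then this is the convexity inequality for all `X, Y` in `O(n)` and all `0 ≤ t ≤ 1`. -/
def MatrixConvexOn {g : ℕ} (O : ∀ n : ℕ, Set (Fin g → Matrix (Fin n) (Fin n) ℝ))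
    (p : NCPoly g) : Prop :=
  ∀ n : ℕ, 0 < n → ∀ X Y : Fin g → Matrix (Fin n) (Fin n) ℝ, segment ℝ X Y ⊆ O n →
    ∀ t : ℝ, 0 ≤ t → t ≤ 1 →
      (t • eval X p + (1 - t) • eval Y p - eval (t • X + (1 - t) • Y) p).PosSemidef

end NCPoly

/-!
Why a symmetric polynomial `p` of degree `d ≥ 3` is not convex on `O`: a point `X` of `O` and its
ampliations `X ⊗ 1` are interior points of `O` among the symmetric tuples, since positive
definiteness of the defining polynomials is an open condition (`eventually_posDef`). So it is
enough to violate the midpoint convexity inequality by arbitrarily small symmetric perturbations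
of `X ⊗ 1` (`MatrixConvexOn.exists_perturbation`).

Let `W` be a word of maximal length `d` in the support of `p`, and put `m = d - 1`. The second
tensor factor has basis `e 0, …, e m`. The perturbation is a weighted cycle graph on this basis:
links from `e k` to `e (k + 1)` in the direction of the variable which is the `k`-th letter of `W`,
counted from the right starting at `0`, and a closing link between `e m` and `e 0` in the direction
of the first letter of `W`. The lower links have weight `r`, the topmost link, from `e (m - 1)` to `e m`, has
weight `s = ± r`, and the closing link has weight `± t`; the midpoint of the two choices of sign is
the perturbation with the lower links alone. Consider the diagonal entry of `p` at the base vector,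
the tensor product of a basis vector with `e 0`.

* For `t = 0` the entry does not depend on `s`: a word sees the topmost link only if it climbs the
  path and returns, which takes length `2 m = 2 (d - 1) > d` (`word_pathTuple_congr`,
  `lift_pathTuple_congr`). Here `d ≥ 3` is used. So the convexity inequality is an equality.
* To first order in `t` only words that run once around the cycle contribute. As no word of `p` is
  longer than `d`, these are `W` and its reversal (`wordDeriv_cycleTuple`), which have
  the same coefficient `c ≠ 0`, and the derivative of the entry is `2 c r ^ (m - 1) s` (`hasDerivAt_lift_cycleTuple`).

The two choices of sign contribute the same first-order term, so the gap in the convexity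
inequality is `4 c r ^ m t + o(t)`, which changes sign at `t = 0`.
-/

namespace NCPoly

open Matrix

/-! ### Words, coefficients and evaluation -/

variable {g : ℕ}

/-- The coefficients of an nc polynomial, indexed by words. -/
noncomputable def wordCoeff (p : NCPoly g) : FreeMonoid (Fin g) →₀ ℝ :=
  (FreeAlgebra.equivMonoidAlgebraFreeMonoid p).coeff

theorem lift_eq_sum_wordCoeff {R : Type*} [Ring R] [Algebra ℝ R] (X : Fin g → R) (p : NCPoly g) :
    FreeAlgebra.lift ℝ X p =
      ∑ w ∈ (wordCoeff p).support, wordCoeff p w • (w.toList.map X).prod := by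
  have h : FreeAlgebra.lift ℝ X =
      (MonoidAlgebra.lift ℝ R (FreeMonoid (Fin g)) (FreeMonoid.lift X)).comp
        (FreeAlgebra.equivMonoidAlgebraFreeMonoid (R := ℝ) (X := Fin g)).toAlgHom := by
    ext i
    simp [FreeAlgebra.equivMonoidAlgebraFreeMonoid]
  rw [h]
  change MonoidAlgebra.lift ℝ R (FreeMonoid (Fin g)) (FreeMonoid.lift X)
    (FreeAlgebra.equivMonoidAlgebraFreeMonoid p) = _
  rw [MonoidAlgebra.lift_apply]
  simp only [Finsupp.sum, wordCoeff, FreeMonoid.lift_apply]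

theorem star_freeMonoidLift_ι (w : FreeMonoid (Fin g)) :
    star (FreeMonoid.lift (FreeAlgebra.ι ℝ) w : NCPoly g) =
      FreeMonoid.lift (FreeAlgebra.ι ℝ) (star w) := by
  induction w using FreeMonoid.inductionOn' with
  | one => simp
  | of_mul x w ih => simp [ih]

theorem wordCoeff_star (p : NCPoly g) (w : FreeMonoid (Fin g)) :
    wordCoeff (star p) w = wordCoeff p (star w) := by
  obtain ⟨f, rfl⟩ :=
    (FreeAlgebra.equivMonoidAlgebraFreeMonoid (R := ℝ) (X := Fin g)).symm.surjective p
  induction f using MonoidAlgebra.induction_linear with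
  | zero => simp [wordCoeff]
  | add f₁ f₂ h₁ h₂ =>
    simp only [wordCoeff, map_add, star_add, MonoidAlgebra.coeff_add, Finsupp.add_apply] at h₁ h₂ ⊢
    rw [h₁, h₂]
  | single m r =>
    have e (m : FreeMonoid (Fin g)) (r : ℝ) :
        (FreeAlgebra.equivMonoidAlgebraFreeMonoid (R := ℝ) (X := Fin g)).symm
          (MonoidAlgebra.single m r) = algebraMap ℝ _ r * FreeMonoid.lift (FreeAlgebra.ι ℝ) m := by
      rw [← Algebra.smul_def]
      exact MonoidAlgebra.lift_single _ _ _
    have s : star ((FreeAlgebra.equivMonoidAlgebraFreeMonoid (R := ℝ) (X := Fin g)).symm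
        (MonoidAlgebra.single m r)) = (FreeAlgebra.equivMonoidAlgebraFreeMonoid).symm
          (MonoidAlgebra.single (star m) r) := by
      rw [e, e, star_mul, FreeAlgebra.star_algebraMap, star_freeMonoidLift_ι, Algebra.commutes]
    rw [s]
    classical
    simp only [wordCoeff, AlgEquiv.apply_symm_apply, MonoidAlgebra.coeff_single,
      Finsupp.single_apply]
    exact if_congr (star_eq_iff_star_eq.trans eq_comm) rfl rfl

theorem transpose_lift {ι : Type*} [Fintype ι] [DecidableEq ι] {X : Fin g → Matrix ι ι ℝ}
    (hX : ∀ i, (X i).IsSymm) (p : NCPoly g) :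
    (FreeAlgebra.lift ℝ X p)ᵀ = FreeAlgebra.lift ℝ X (star p) := by
  induction p using FreeAlgebra.induction with
  | grade0 r => simp [Matrix.algebraMap_eq_diagonal]
  | grade1 i => simpa using (hX i).eq
  | mul a b ha hb => simp [Matrix.transpose_mul, ha, hb]
  | add a b ha hb => simp [ha, hb]

/-! ### Positivity on a neighbourhood of an ampliation -/

/-- Positive definiteness is an open condition among symmetric matrices: the unit sphere is
compact, so positivity of the quadratic form on it persists under small perturbations. -/
theorem eventually_posDef {ι : Type*} [Fintype ι] [DecidableEq ι] {M : Matrix ι ι ℝ}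
    (hM : M.PosDef) : ∀ᶠ N in nhds M, N.IsSymm → N.PosDef := by
  have hcont : Continuous fun z : Matrix ι ι ℝ × EuclideanSpace ℝ ι =>
      z.2.ofLp ⬝ᵥ (z.1 *ᵥ z.2.ofLp) := by fun_prop
  have key : ∀ᶠ N in nhds M, ∀ x ∈ Metric.sphere (0 : EuclideanSpace ℝ ι) 1,
      0 < x.ofLp ⬝ᵥ (N *ᵥ x.ofLp) := by
    refine (isCompact_sphere _ _).eventually_forall_of_forall_eventually fun x hx => ?_
    refine (hcont.tendsto (M, x)).eventually (lt_mem_nhds ?_)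
    have hx0 : x.ofLp ≠ 0 := by
      intro h
      have : x = 0 := by ext i; simp [h]
      simp [this] at hx
    simpa using hM.dotProduct_mulVec_pos hx0
  filter_upwards [key] with N hN hsymm
  refine PosDef.of_dotProduct_mulVec_pos (by simpa [IsHermitian] using hsymm.eq) fun x hx => ?_
  set y : EuclideanSpace ℝ ι := WithLp.toLp 2 x with hy
  have hy0 : 0 < ‖y‖ := norm_pos_iff.2 fun h => hx (by simpa [hy] using h)
  have := hN (‖y‖⁻¹ • y) (by simp [norm_smul, hy0.ne'])
  simp only [WithLp.ofLp_smul, mulVec_smul, dotProduct_smul, smul_dotProduct, smul_eq_mul,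
    ← mul_assoc, hy] at this
  simpa using pos_of_mul_pos_right this (by positivity)

theorem lift_kronecker_one {ι κ : Type*} [Fintype ι] [DecidableEq ι] [Fintype κ] [DecidableEq κ]
    (X : Fin g → Matrix ι ι ℝ) (p : NCPoly g) :
    FreeAlgebra.lift ℝ (fun i => kroneckerMap (· * ·) (X i) (1 : Matrix κ κ ℝ)) p =
      kroneckerMap (· * ·) (FreeAlgebra.lift ℝ X p) 1 := by
  induction p using FreeAlgebra.induction with
  | grade0 r =>
    simp only [AlgHom.commutes]
    simp only [Algebra.algebraMap_eq_smul_one, smul_kronecker, one_kronecker_one]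
  | grade1 i => simp
  | mul a b ha hb => simp [ha, hb, ← mul_kronecker_mul]
  | add a b ha hb => simp [ha, hb, add_kronecker]

theorem continuous_lift {ι T : Type*} [Fintype ι] [DecidableEq ι] [TopologicalSpace T]
    {Z : T → Fin g → Matrix ι ι ℝ} (hZ : Continuous Z) (p : NCPoly g) :
    Continuous fun s => FreeAlgebra.lift ℝ (Z s) p := by
  induction p using FreeAlgebra.induction with
  | grade0 r => simpa using continuous_const
  | grade1 i => simpa [Function.comp_def] using (continuous_apply i).comp hZ
  | mul a b ha hb => simp only [map_mul]; fun_prop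
  | add a b ha hb => simp only [map_add]; fun_prop

/-! ### Directional derivatives of words -/

section wordDeriv

variable {ι : Type*} [Fintype ι] [DecidableEq ι]

/-- The derivative at `t = 0` of `t ↦ w(Z + t A)` for a word `w`, given by the Leibniz rule. -/
noncomputable def wordDeriv (Z A : Fin g → Matrix ι ι ℝ) : List (Fin g) → Matrix ι ι ℝ
  | [] => 0
  | i :: w => A i * (w.map Z).prod + Z i * wordDeriv Z A w

theorem hasDerivAt_word (Z A : Fin g → Matrix ι ι ℝ) (w : List (Fin g)) (a b : ι) :
    HasDerivAt (fun t : ℝ => (w.map (Z + t • A)).prod a b) (wordDeriv Z A w a b) 0 := by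
  induction w generalizing a with
  | nil => simpa [wordDeriv] using hasDerivAt_const (0 : ℝ) ((1 : Matrix ι ι ℝ) a b)
  | cons i w ih =>
    have h : ∀ c, HasDerivAt (fun t : ℝ => (Z i a c + t * A i a c) * (w.map (Z + t • A)).prod c b)
        (A i a c * (w.map Z).prod c b + Z i a c * wordDeriv Z A w c b) 0 := fun c => by
      simpa using (((hasDerivAt_id' (0 : ℝ)).mul_const (A i a c)).const_add (Z i a c)).fun_mul (ih c)
    simpa [wordDeriv, mul_apply, Finset.sum_add_distrib] using
      HasDerivAt.fun_sum (u := Finset.univ) fun c _ => h c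

theorem wordDeriv_add (Z A B : Fin g → Matrix ι ι ℝ) (w : List (Fin g)) :
    wordDeriv Z (A + B) w = wordDeriv Z A w + wordDeriv Z B w := by
  induction w with
  | nil => simp [wordDeriv]
  | cons i w ih => simp only [wordDeriv, ih, Pi.add_apply, add_mul, mul_add]; abel

theorem wordDeriv_append (Z A : Fin g → Matrix ι ι ℝ) (u v : List (Fin g)) :
    wordDeriv Z A (u ++ v) =
      wordDeriv Z A u * (v.map Z).prod + (u.map Z).prod * wordDeriv Z A v := by
  induction u with
  | nil => simp [wordDeriv]
  | cons i u ih => simp [wordDeriv, ih, add_mul, mul_add, mul_assoc, add_assoc]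

theorem transpose_word {Z : Fin g → Matrix ι ι ℝ} (hZ : ∀ i, (Z i).IsSymm) (w : List (Fin g)) :
    ((w.map Z).prod)ᵀ = (w.reverse.map Z).prod := by
  induction w with
  | nil => simp
  | cons i w ih => simp [transpose_mul, ih, (hZ i).eq]

theorem transpose_wordDeriv {Z : Fin g → Matrix ι ι ℝ} (hZ : ∀ i, (Z i).IsSymm)
    (A : Fin g → Matrix ι ι ℝ) (w : List (Fin g)) :
    (wordDeriv Z A w)ᵀ = wordDeriv Z (fun i => (A i)ᵀ) w.reverse := by
  induction w with
  | nil => simp [wordDeriv]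
  | cons i w ih =>
    simp [wordDeriv, wordDeriv_append, transpose_mul, ih, (hZ i).eq, transpose_word hZ, add_comm]

end wordDeriv

/-! ### The tridiagonal path representation of a word -/

/-- The word `ℓ (k - 1) ⋯ ℓ 1 ℓ 0` of length `k`: the letters read off while climbing from level
`0` to level `k`, the last one leftmost, as in a product of operators. -/
def pathWord (ℓ : ℕ → Fin g) : ℕ → List (Fin g)
  | 0 => []
  | k + 1 => ℓ k :: pathWord ℓ k

theorem pathWord_congr {ℓ ℓ' : ℕ → Fin g} {k : ℕ} (h : ∀ q < k, ℓ q = ℓ' q) :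
    pathWord ℓ k = pathWord ℓ' k := by
  induction k with
  | zero => rfl
  | succ k ih => rw [pathWord, pathWord, h k (by omega), ih fun q hq => h q (by omega)]

theorem length_pathWord (ℓ : ℕ → Fin g) (k : ℕ) : (pathWord ℓ k).length = k := by
  induction k with
  | zero => rfl
  | succ k ih => simp [pathWord, ih]

theorem exists_pathWord_eq (i : Fin g) (w : List (Fin g)) :
    ∃ ℓ : ℕ → Fin g, pathWord ℓ w.length = w := by
  induction w with
  | nil => exact ⟨fun _ => i, rfl⟩
  | cons j w ih =>
    obtain ⟨ℓ, hℓ⟩ := ih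
    refine ⟨Function.update ℓ w.length j, ?_⟩
    have : pathWord (Function.update ℓ w.length j) w.length = pathWord ℓ w.length :=
      pathWord_congr fun q hq => Function.update_of_ne hq.ne _ _
    simp [pathWord, this, hℓ]

/-- The symmetric tridiagonal matrix on levels `0, …, m` with zero diagonal that joins the levels
`k` and `k + 1` with weight `a k` whenever the letter `ℓ k` is `j`. -/
def pathMatrix (m : ℕ) (ℓ : ℕ → Fin g) (a : ℕ → ℝ) (j : Fin g) :
    Matrix (Fin (m + 1)) (Fin (m + 1)) ℝ :=
  of fun k l => if (k : ℕ) + 1 = l ∧ ℓ k = j then a k else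
    if (l : ℕ) + 1 = k ∧ ℓ l = j then a l else 0

section pathTuple

variable {ι : Type*} [DecidableEq ι]

/-- The tuple `X ⊗ 1 + 1 ⊗ J`, where `J` is the tuple of the matrices `pathMatrix m ℓ a`. -/
def pathTuple (X : Fin g → Matrix ι ι ℝ) (m : ℕ) (ℓ : ℕ → Fin g) (a : ℕ → ℝ) :
    Fin g → Matrix (ι × Fin (m + 1)) (ι × Fin (m + 1)) ℝ :=
  fun j => kroneckerMap (· * ·) (X j) 1 + kroneckerMap (· * ·) 1 (pathMatrix m ℓ a j)

variable {X : Fin g → Matrix ι ι ℝ} {m : ℕ} {ℓ : ℕ → Fin g} {a : ℕ → ℝ}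

theorem isSymm_pathTuple (hX : ∀ i, (X i).IsSymm) (j : Fin g) :
    (pathTuple X m ℓ a j).IsSymm := by
  ext ⟨x, k⟩ ⟨y, l⟩
  have h : X j y x = X j x y := (hX j).apply x y
  have h' : pathMatrix m ℓ a j l k = pathMatrix m ℓ a j k l := by
    simp only [pathMatrix, of_apply]
    split_ifs <;> first | rfl | omega
  simp [pathTuple, h, h', one_apply, eq_comm]

/-- Each matrix of `pathTuple` raises the level by at most one. -/
theorem pathTuple_apply_of_lt {x y : ι} {k l : Fin (m + 1)} (h : (l : ℕ) + 1 < k) (j : Fin g) :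
    pathTuple X m ℓ a j (x, k) (y, l) = 0 := by
  have h₁ : k ≠ l := by rintro rfl; omega
  have h₂ : ¬(k : ℕ) + 1 = l := by omega
  simp [pathTuple, pathMatrix, one_apply, h₁, h₂, h.ne]

theorem pathTuple_apply_of_gt {x y : ι} {k l : Fin (m + 1)} (h : (k : ℕ) + 1 < l) (j : Fin g) :
    pathTuple X m ℓ a j (x, k) (y, l) = 0 := by
  have h₁ : k ≠ l := by rintro rfl; omega
  have h₂ : ¬(l : ℕ) + 1 = k := by omega
  simp [pathTuple, pathMatrix, one_apply, h₁, h₂, h.ne]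

theorem pathTuple_apply_of_eq {x y : ι} {k l : Fin (m + 1)} (h : (l : ℕ) + 1 = k) (j : Fin g) :
    pathTuple X m ℓ a j (x, k) (y, l) = if x = y ∧ ℓ l = j then a l else 0 := by
  have h₁ : k ≠ l := by rintro rfl; omega
  have h₂ : ¬(k : ℕ) + 1 = l := by omega
  by_cases hxy : x = y <;> simp [pathTuple, pathMatrix, one_apply, h₁, h₂, h, hxy]

section word

variable [Fintype ι]

/-- A word shorter than `k` does not reach level `k` from level `0`. -/
theorem word_pathTuple_of_lt {w : List (Fin g)} {x o : ι} {k : Fin (m + 1)} (h : w.length < k) :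
    (w.map (pathTuple X m ℓ a)).prod (x, k) (o, 0) = 0 := by
  induction w generalizing x k with
  | nil =>
    have : k ≠ 0 := by rintro rfl; simp at h
    simp [one_apply, this]
  | cons i w ih =>
    rw [List.map_cons, List.prod_cons, mul_apply]
    refine Finset.sum_eq_zero fun ⟨y, l⟩ _ => ?_
    rw [List.length_cons] at h
    by_cases hl : w.length < l
    · rw [ih hl, mul_zero]
    · rw [pathTuple_apply_of_lt (by omega), zero_mul]

/-- Among the words of length `k` only `pathWord ℓ k` reaches level `k` from level `0`. -/
theorem word_pathTuple_of_eq {w : List (Fin g)} {x o : ι} {k : Fin (m + 1)} (h : w.length = k) :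
    (w.map (pathTuple X m ℓ a)).prod (x, k) (o, 0) =
      if x = o ∧ w = pathWord ℓ k then ∏ q ∈ Finset.range k, a q else 0 := by
  induction w generalizing x k with
  | nil =>
    obtain rfl : k = 0 := Fin.ext (by simpa using h.symm)
    simp [one_apply, pathWord]
  | cons i w ih =>
    rw [List.length_cons] at h
    have hk := k.isLt
    set l : Fin (m + 1) := ⟨w.length, by omega⟩ with hl
    rw [List.map_cons, List.prod_cons, mul_apply, Finset.sum_eq_single (x, l)]
    · rw [pathTuple_apply_of_eq (by simpa [hl] using h), ih (by simp [hl]), ← h, pathWord,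
        Finset.prod_range_succ]
      simp only [true_and, List.cons.injEq, hl]
      split_ifs <;> grind
    · rintro ⟨y, l'⟩ - hne
      rcases lt_trichotomy w.length (l' : ℕ) with h' | h' | h'
      · rw [word_pathTuple_of_lt h', mul_zero]
      · have : x ≠ y := by
          rintro rfl
          exact hne (Prod.ext rfl (Fin.ext h'.symm))
        rw [pathTuple_apply_of_eq (by omega), if_neg (by tauto), zero_mul]
      · rw [pathTuple_apply_of_lt (by omega), zero_mul]
    · simp

/-- The weight of the topmost link does not influence entries which a word can only reach by
walks that are too short to climb the whole path and return. -/
theorem word_pathTuple_congr {a' : ℕ → ℝ} (ha : ∀ q, q + 1 < m → a q = a' q)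
    {w : List (Fin g)} {x o : ι} {k : Fin (m + 1)} (hk : (k : ℕ) < m)
    (h : w.length + k < 2 * m) :
    (w.map (pathTuple X m ℓ a)).prod (x, k) (o, 0) =
      (w.map (pathTuple X m ℓ a')).prod (x, k) (o, 0) := by
  induction w generalizing x k with
  | nil => simp
  | cons i w ih =>
    rw [List.length_cons] at h
    simp only [List.map_cons, List.prod_cons, mul_apply]
    refine Finset.sum_congr rfl fun ⟨y, l⟩ _ => ?_
    by_cases h₁ : w.length < l
    · rw [word_pathTuple_of_lt h₁, word_pathTuple_of_lt h₁, mul_zero, mul_zero]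
    by_cases h₂ : (k : ℕ) + 1 < l
    · rw [pathTuple_apply_of_gt h₂, pathTuple_apply_of_gt h₂, zero_mul, zero_mul]
    have hl : (l : ℕ) < m := by omega
    rw [ih hl (by omega)]
    congr 1
    simp only [pathTuple, pathMatrix, Matrix.add_apply, kroneckerMap_apply, of_apply]
    congr 2
    split_ifs
    · exact ha _ (by omega)
    · exact ha _ (by omega)
    · rfl

end word

/-! ### Closing the path to a cycle -/

/-- The rank one tuple that returns from the top level `m` to the level `0` by the letter `ℓ m`. -/
def returnTuple (o : ι) (m : ℕ) (ℓ : ℕ → Fin g) :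
    Fin g → Matrix (ι × Fin (m + 1)) (ι × Fin (m + 1)) ℝ :=
  fun j => if j = ℓ m then single (o, 0) (o, Fin.last m) 1 else 0

/-- The symmetrization of `returnTuple`. -/
def cycleTuple (o : ι) (m : ℕ) (ℓ : ℕ → Fin g) :
    Fin g → Matrix (ι × Fin (m + 1)) (ι × Fin (m + 1)) ℝ :=
  returnTuple o m ℓ + fun j => (returnTuple o m ℓ j)ᵀ

theorem isSymm_cycleTuple (o : ι) (j : Fin g) : (cycleTuple o m ℓ j).IsSymm :=
  isSymm_add_transpose_self _

variable [Fintype ι]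

theorem wordDeriv_returnTuple_of_le {w : List (Fin g)} {o : ι} (h : w.length ≤ m)
    (b : ι × Fin (m + 1)) :
    wordDeriv (pathTuple X m ℓ a) (returnTuple o m ℓ) w b (o, 0) = 0 := by
  induction w generalizing b with
  | nil => simp [wordDeriv]
  | cons i w ih =>
    rw [List.length_cons] at h
    have h₀ : (w.map (pathTuple X m ℓ a)).prod (o, Fin.last m) (o, 0) = 0 :=
      word_pathTuple_of_lt (by simpa using h)
    rw [wordDeriv, Matrix.add_apply, mul_apply (M := pathTuple X m ℓ a i),
      Finset.sum_eq_zero fun c _ => by rw [ih (by omega), mul_zero], add_zero, returnTuple]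
    split_ifs
    · by_cases hb : b = (o, 0)
      · rw [hb, single_mul_apply_same, h₀, mul_zero]
      · rw [single_mul_apply_of_ne _ _ _ _ _ hb]
    · simp

/-- A word of length at most `m + 1` contributes to the first-order return amplitude only if it
goes once around the cycle. -/
theorem wordDeriv_returnTuple {w : List (Fin g)} {o : ι} (h : w.length ≤ m + 1) :
    wordDeriv (pathTuple X m ℓ a) (returnTuple o m ℓ) w (o, 0) (o, 0) =
      if w = pathWord ℓ (m + 1) then ∏ q ∈ Finset.range m, a q else 0 := by
  rcases h.lt_or_eq with h | h
  · rw [wordDeriv_returnTuple_of_le (by omega), if_neg]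
    rintro rfl
    simp [length_pathWord] at h
  · obtain _ | ⟨i, w⟩ := w
    · simp at h
    have h' : w.length = m := by simpa using h
    rw [wordDeriv, Matrix.add_apply, mul_apply (M := pathTuple X m ℓ a i),
      Finset.sum_eq_zero fun c _ => by rw [wordDeriv_returnTuple_of_le h'.le, mul_zero], add_zero,
      returnTuple, pathWord]
    split_ifs with h₁ h₂ h₂
    · rw [single_mul_apply_same, word_pathTuple_of_eq (by simpa using h')]
      simp_all
    · rw [single_mul_apply_same, word_pathTuple_of_eq (by simpa using h')]
      simp_all
    · simp_all
    · simp

theorem wordDeriv_cycleTuple (hX : ∀ i, (X i).IsSymm) {w : List (Fin g)} {o : ι}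
    (h : w.length ≤ m + 1) :
    wordDeriv (pathTuple X m ℓ a) (cycleTuple o m ℓ) w (o, 0) (o, 0) =
      (if w = pathWord ℓ (m + 1) then ∏ q ∈ Finset.range m, a q else 0) +
      if w.reverse = pathWord ℓ (m + 1) then ∏ q ∈ Finset.range m, a q else 0 := by
  have key := transpose_wordDeriv (isSymm_pathTuple (m := m) (ℓ := ℓ) (a := a) hX)
    (returnTuple o m ℓ) w.reverse
  rw [List.reverse_reverse] at key
  rw [cycleTuple, wordDeriv_add, Matrix.add_apply, ← key, transpose_apply, wordDeriv_returnTuple h,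
    wordDeriv_returnTuple (by simpa using h)]

end pathTuple

/-! ### Polynomials on the cycle -/

section cycle

variable {ι : Type*} [Fintype ι] [DecidableEq ι] {X : Fin g → Matrix ι ι ℝ} {m : ℕ}
  {ℓ : ℕ → Fin g} {p : NCPoly g}

theorem lift_apply_eq_sum {κ : Type*} [Fintype κ] [DecidableEq κ] (Z : Fin g → Matrix κ κ ℝ)
    (p : NCPoly g) (b c : κ) :
    FreeAlgebra.lift ℝ Z p b c =
      ∑ w ∈ (wordCoeff p).support, wordCoeff p w * (w.toList.map Z).prod b c := by
  simp [lift_eq_sum_wordCoeff, Matrix.sum_apply]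

/-- To first order, closing the path of a word `w` of maximal length to a cycle makes a symmetric
polynomial see exactly the coefficients of `w` and of its reversal, which agree. -/
theorem hasDerivAt_lift_cycleTuple (hp : p.IsSymmetric) (hX : ∀ i, (X i).IsSymm)
    (hdeg : ∀ w ∈ (wordCoeff p).support, w.toList.length ≤ m + 1) (a : ℕ → ℝ) (o : ι) :
    HasDerivAt
      (fun t : ℝ => FreeAlgebra.lift ℝ (pathTuple X m ℓ a + t • cycleTuple o m ℓ) p (o, 0) (o, 0))
      (2 * wordCoeff p (FreeMonoid.ofList (pathWord ℓ (m + 1))) * ∏ q ∈ Finset.range m, a q) 0 := by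
  classical
  simp only [lift_apply_eq_sum]
  set W := FreeMonoid.ofList (pathWord ℓ (m + 1)) with hW
  set P := ∏ q ∈ Finset.range m, a q with hP
  have h₁ : ∑ w ∈ (wordCoeff p).support, (if w = W then wordCoeff p w * P else 0) =
      wordCoeff p W * P := by
    rw [Finset.sum_ite_eq']
    split_ifs with h
    · rfl
    · rw [Finsupp.notMem_support_iff.1 h, zero_mul]
  have h₂ : ∑ w ∈ (wordCoeff p).support, (if w = star W then wordCoeff p w * P else 0) =
      wordCoeff p W * P := by
    have hs : wordCoeff p (star W) = wordCoeff p W := by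
      rw [← wordCoeff_star, show star p = p from hp]
    rw [Finset.sum_ite_eq', hs]
    split_ifs with h
    · rfl
    · rw [← hs, Finsupp.notMem_support_iff.1 h, zero_mul]
  have h : 2 * wordCoeff p W * P = ∑ w ∈ (wordCoeff p).support, wordCoeff p w *
      wordDeriv (pathTuple X m ℓ a) (cycleTuple o m ℓ) w.toList (o, 0) (o, 0) := by
    rw [mul_assoc, two_mul]
    nth_rewrite 1 [← h₁]
    rw [← h₂, ← Finset.sum_add_distrib]
    refine Finset.sum_congr rfl fun w hw => ?_
    rw [wordDeriv_cycleTuple hX (hdeg w hw), mul_add, mul_ite, mul_ite, mul_zero]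
    exact congr_arg₂ _ (if_congr Iff.rfl rfl rfl)
      (if_congr ((eq_star_iff_eq_star (r := w) (s := W)).trans eq_comm) rfl rfl)
  rw [h]
  exact HasDerivAt.fun_sum fun w _ => (hasDerivAt_word _ _ _ _ _).const_mul _

/-- Since `2 m > m + 1`, no word of a polynomial of degree at most `m + 1` climbs the path and
returns, and so the weight of the topmost link does not matter. -/
theorem lift_pathTuple_congr {a a' : ℕ → ℝ} (hm : 2 ≤ m) (ha : ∀ q, q + 1 < m → a q = a' q)
    (hdeg : ∀ w ∈ (wordCoeff p).support, w.toList.length ≤ m + 1) (o : ι) :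
    FreeAlgebra.lift ℝ (pathTuple X m ℓ a) p (o, 0) (o, 0) =
      FreeAlgebra.lift ℝ (pathTuple X m ℓ a') p (o, 0) (o, 0) := by
  simp only [lift_apply_eq_sum]
  refine Finset.sum_congr rfl fun w hw => ?_
  have := hdeg w hw
  rw [word_pathTuple_congr ha (by simp; omega) (by simp; omega)]

end cycle

/-! ### Convexity along a perturbed ampliation -/

theorem eval_reindex {ι : Type*} [Fintype ι] [DecidableEq ι] {N : ℕ} (e : ι ≃ Fin N)
    (Z : Fin g → Matrix ι ι ℝ) (p : NCPoly g) :
    eval (fun i => reindexAlgEquiv ℝ ℝ e (Z i)) p =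
      reindexAlgEquiv ℝ ℝ e (FreeAlgebra.lift ℝ Z p) := by
  have : FreeAlgebra.lift ℝ (fun i => reindexAlgEquiv ℝ ℝ e (Z i)) =
      (reindexAlgEquiv ℝ ℝ e).toAlgHom.comp (FreeAlgebra.lift ℝ Z) := by
    ext i; simp
  exact DFunLike.congr_fun this p

/-- Midpoint convexity on diagonal entries, for matrices indexed by an arbitrary finite type. -/
theorem MatrixConvexOn.diag_add_ge {O : ∀ n : ℕ, Set (Fin g → Matrix (Fin n) (Fin n) ℝ)}
    {p : NCPoly g} (hconv : MatrixConvexOn O p) {k : ℕ} {q : Fin k → NCPoly g}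
    (hO : ∀ n : ℕ, 0 < n → O n = {X | X ∈ SymTuples g n ∧ ∀ j, (eval X (q j)).PosDef})
    {ι : Type*} [Fintype ι] [DecidableEq ι] {X Y Z : Fin g → Matrix ι ι ℝ}
    (hseg : ∀ V ∈ segment ℝ X Y,
      (∀ i, (V i).IsSymm) ∧ ∀ j, (FreeAlgebra.lift ℝ V (q j)).PosDef)
    (hZ : Z = (2 : ℝ)⁻¹ • X + (2 : ℝ)⁻¹ • Y) (b : ι) :
    2 * FreeAlgebra.lift ℝ Z p b b ≤
      FreeAlgebra.lift ℝ X p b b + FreeAlgebra.lift ℝ Y p b b := by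
  have hN : 0 < Fintype.card ι := Fintype.card_pos_iff.2 ⟨b⟩
  let e : ι ≃ Fin (Fintype.card ι) := Fintype.equivFin ι
  let φ : (Fin g → Matrix ι ι ℝ) → Fin g → Matrix (Fin (Fintype.card ι)) (Fin (Fintype.card ι)) ℝ :=
    fun V i => reindexAlgEquiv ℝ ℝ e (V i)
  have hφ (r s : ℝ) (V W : Fin g → Matrix ι ι ℝ) : φ (r • V + s • W) = r • φ V + s • φ W := by
    ext; simp [φ]
  have hsub : segment ℝ (φ X) (φ Y) ⊆ O (Fintype.card ι) := by
    rintro _ ⟨r, s, hr, hs, hrs, rfl⟩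
    obtain ⟨h₁, h₂⟩ := hseg _ ⟨r, s, hr, hs, hrs, rfl⟩
    rw [hO _ hN, ← hφ]
    refine ⟨fun i => (h₁ i).submatrix _, fun j => ?_⟩
    rw [eval_reindex]
    exact (h₂ j).submatrix e.symm.injective
  have h := (hconv _ hN _ _ hsub 2⁻¹ (by norm_num) (by norm_num)).diag_nonneg (i := e b)
  rw [show (1 : ℝ) - 2⁻¹ = 2⁻¹ by norm_num, ← hφ, ← hZ, eval_reindex, eval_reindex,
    eval_reindex] at h
  simp at h
  linarith

/-- The weights equal to `s` on the topmost of `m` links and to `r` on the others. -/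
def linkWeight (m : ℕ) (r s : ℝ) (q : ℕ) : ℝ := if q + 1 = m then s else r

section perturbation

variable {n : ℕ} (X : Fin g → Matrix (Fin n) (Fin n) ℝ) (m : ℕ) (ℓ : ℕ → Fin g) (o : Fin n)

/-- The perturbation of the ampliation `X ⊗ 1` which depends affinely on the weight `z.1` of the
lower links, the weight `z.2.1` of the topmost link, and the weight `z.2.2` of the closing link. -/
def perturbedTuple (z : ℝ × ℝ × ℝ) : Fin g → Matrix (Fin n × Fin (m + 1)) (Fin n × Fin (m + 1)) ℝ :=
  pathTuple X m ℓ (linkWeight m z.1 z.2.1) + z.2.2 • cycleTuple o m ℓ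

theorem continuous_perturbedTuple : Continuous (perturbedTuple X m ℓ o) := by
  refine continuous_pi fun j => continuous_matrix fun b c => ?_
  simp only [perturbedTuple, pathTuple, pathMatrix, linkWeight, Pi.add_apply, Pi.smul_apply,
    Matrix.add_apply, Matrix.smul_apply, kroneckerMap_apply, of_apply]
  split_ifs <;> fun_prop

theorem perturbedTuple_zero :
    perturbedTuple X m ℓ o 0 = fun j => kroneckerMap (· * ·) (X j) 1 := by
  ext j b c
  simp [perturbedTuple, pathTuple, pathMatrix, linkWeight]

theorem perturbedTuple_combination {r s : ℝ} (h : r + s = 1) (y z : ℝ × ℝ × ℝ) :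
    perturbedTuple X m ℓ o (r • y + s • z) =
      r • perturbedTuple X m ℓ o y + s • perturbedTuple X m ℓ o z := by
  obtain rfl : s = 1 - r := by linarith
  ext j b c
  simp only [perturbedTuple, pathTuple, pathMatrix, linkWeight, Pi.add_apply, Pi.smul_apply,
    Matrix.add_apply, Matrix.smul_apply, kroneckerMap_apply, of_apply, Prod.fst_add, Prod.snd_add,
    Prod.smul_fst, Prod.smul_snd, smul_eq_mul]
  split_ifs <;> ring

end perturbation

/-- The convexity inequality at the base vector for the two perturbations `(r, ± s, ± t)` of an
ampliation of a point of `O`. -/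
theorem MatrixConvexOn.exists_perturbation {O : ∀ n : ℕ, Set (Fin g → Matrix (Fin n) (Fin n) ℝ)}
    {p : NCPoly g} (hconv : MatrixConvexOn O p) (hO : IsBasicOpenSemialgebraic O)
    {n : ℕ} {X : Fin g → Matrix (Fin n) (Fin n) ℝ} (hX : X ∈ O n) (o : Fin n) (m : ℕ)
    (ℓ : ℕ → Fin g) :
    (∀ i, (X i).IsSymm) ∧ ∃ r : ℝ, 0 < r ∧ ∀ᶠ t in nhds (0 : ℝ),
      2 * FreeAlgebra.lift ℝ (perturbedTuple X m ℓ o (r, 0, 0)) p (o, 0) (o, 0) ≤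
        FreeAlgebra.lift ℝ (perturbedTuple X m ℓ o (r, r, t)) p (o, 0) (o, 0) +
        FreeAlgebra.lift ℝ (perturbedTuple X m ℓ o (r, -r, -t)) p (o, 0) (o, 0) := by
  obtain ⟨k, q, hq, hO⟩ := hO
  rw [hO n o.pos] at hX
  obtain ⟨hsymm, hpos⟩ := hX
  refine ⟨hsymm, ?_⟩
  have hsymm' (z : ℝ × ℝ × ℝ) (i : Fin g) : (perturbedTuple X m ℓ o z i).IsSymm :=
    (isSymm_pathTuple hsymm i).add (IsSymm.smul (isSymm_cycleTuple o i) z.2.2)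
  have hev : ∀ᶠ z in nhds (0 : ℝ × ℝ × ℝ), ∀ j,
      (FreeAlgebra.lift ℝ (perturbedTuple X m ℓ o z) (q j)).PosDef := by
    refine Filter.eventually_all.2 fun j => ?_
    have h₀ : (FreeAlgebra.lift ℝ (perturbedTuple X m ℓ o 0) (q j)).PosDef := by
      rw [perturbedTuple_zero, lift_kronecker_one]
      exact (hpos j).kronecker PosDef.one
    have hc := (continuous_lift (continuous_perturbedTuple X m ℓ o) (q j)).tendsto 0
    filter_upwards [hc.eventually (eventually_posDef h₀)] with z hz
    refine hz ?_
    rw [IsSymm, transpose_lift (hsymm' z), show star (q j) = q j from hq j]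
  obtain ⟨δ, hδ, hball⟩ := Metric.eventually_nhds_iff_ball.1 hev
  refine ⟨δ / 2, by positivity, ?_⟩
  filter_upwards [Metric.ball_mem_nhds (0 : ℝ) hδ] with t ht
  have ht' : |t| < δ := by simpa using ht
  have hr : |δ| / 2 < δ := by rw [abs_of_pos hδ]; linarith
  have h₁ : ((δ / 2, δ / 2, t) : ℝ × ℝ × ℝ) ∈ Metric.ball 0 δ := by
    simp [Prod.norm_def, ht', hr]
  have h₂ : ((δ / 2, -(δ / 2), -t) : ℝ × ℝ × ℝ) ∈ Metric.ball 0 δ := by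
    simp [Prod.norm_def, ht', hr]
  refine hconv.diag_add_ge hO (fun V hV => ?_) ?_ _
  · obtain ⟨r, s, hr, hs, hrs, rfl⟩ := hV
    rw [← perturbedTuple_combination X m ℓ o hrs]
    exact ⟨hsymm' _, hball _ (convex_ball _ _ h₁ h₂ hr hs hrs)⟩
  · rw [← perturbedTuple_combination X m ℓ o (by norm_num)]
    congr 1
    ext
    · simp; ring
    · simp
    · simp

end NCPoly

theorem mainTheorem1 (g : ℕ) (p : NCPoly g) (hp : p.IsSymmetric)
    (O : ∀ n : ℕ, Set (Fin g → Matrix (Fin n) (Fin n) ℝ))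
    (hO : NCPoly.IsBasicOpenSemialgebraic O)
    (hne : ∃ n : ℕ, 0 < n ∧ (O n).Nonempty)
    (hconv : NCPoly.MatrixConvexOn O p) :
    p.degree ≤ 2 := by
  by_contra hcon
  obtain ⟨n, hn, X, hX⟩ := hne
  -- A word `W` of maximal length in the support, which is then longer than `2`.
  have hne' : (NCPoly.wordCoeff p).support.Nonempty := by
    rw [Finset.nonempty_iff_ne_empty]
    intro h
    exact hcon (by simp [NCPoly.degree,
      show (FreeAlgebra.equivMonoidAlgebraFreeMonoid p).coeff.support = ∅ from h])
  obtain ⟨W, hW, hmax⟩ := Finset.exists_max_image _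
    (fun w : FreeMonoid (Fin g) => w.toList.length) hne'
  have hlen : 2 < W.toList.length := by
    by_contra hle
    refine hcon (Finset.sup_le fun w hw => ?_)
    have h : w.length ≤ 2 := (hmax w hw).trans (not_lt.1 hle)
    exact_mod_cast h
  obtain ⟨ℓ, hℓ⟩ := NCPoly.exists_pathWord_eq
    (W.toList.head (by rintro h; simp [h] at hlen)) W.toList
  obtain ⟨m, hm⟩ : ∃ m, W.toList.length = m + 2 := ⟨W.toList.length - 2, by omega⟩
  rw [hm] at hℓ
  have hdeg : ∀ w ∈ (NCPoly.wordCoeff p).support, w.toList.length ≤ m + 1 + 1 :=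
    fun w hw => (hmax w hw).trans hm.le
  let o : Fin n := ⟨0, hn⟩
  obtain ⟨hsymm, r, hr, hev⟩ := hconv.exists_perturbation hO hX o (m + 1) ℓ
  set f : ℝ → ℝ → ℝ := fun s t =>
    FreeAlgebra.lift ℝ (NCPoly.perturbedTuple X (m + 1) ℓ o (r, s, t)) p (o, 0) (o, 0) with hf
  -- At `t = 0` the convexity inequality is an equality, because the topmost link is invisible.
  have hf₀ (s : ℝ) : f s 0 = f 0 0 := by
    simp only [hf, NCPoly.perturbedTuple, zero_smul, add_zero]
    refine NCPoly.lift_pathTuple_congr (by omega) (fun q hq => ?_) hdeg o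
    simp only [NCPoly.linkWeight, if_neg hq.ne]
  have hf' (s : ℝ) : HasDerivAt (f s) (2 * NCPoly.wordCoeff p W * (r ^ m * s)) 0 := by
    have h := NCPoly.hasDerivAt_lift_cycleTuple (ℓ := ℓ) hp hsymm hdeg
      (NCPoly.linkWeight (m + 1) r s) o
    have hprod : ∏ q ∈ Finset.range (m + 1), NCPoly.linkWeight (m + 1) r s q = r ^ m * s := by
      have h (q : ℕ) (hq : q ∈ Finset.range m) : NCPoly.linkWeight (m + 1) r s q = r :=
        if_neg (by simpa using (Finset.mem_range.1 hq).ne)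
      rw [Finset.prod_range_succ, Finset.prod_congr rfl h]
      simp [NCPoly.linkWeight]
    rw [hℓ, hprod] at h
    exact h
  have hmin : IsLocalMin (fun t => f r t + f (-r) (-t)) 0 := by
    filter_upwards [hev] with t ht
    simp only [neg_zero, hf₀]
    linarith
  have hd : HasDerivAt (fun t => f r t + f (-r) (-t))
      (2 * NCPoly.wordCoeff p W * (r ^ m * r) + -(2 * NCPoly.wordCoeff p W * (r ^ m * -r))) 0 := by
    refine (hf' r).fun_add ?_
    have h := hf' (-r)
    rw [← neg_zero] at h
    simpa [Function.comp_def] using h.scomp (0 : ℝ) (hasDerivAt_neg (0 : ℝ))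
  -- The two contributions to the derivative add up, since both the topmost and the closing link
  -- change sign.
  have h0 := hmin.hasDerivAt_eq_zero hd
  have hc : NCPoly.wordCoeff p W ≠ 0 := Finsupp.mem_support_iff.1 hW
  have : 4 * NCPoly.wordCoeff p W * r ^ (m + 1) = 0 := by rw [← h0]; ring
  simp [hc, hr.ne'] at this
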